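/- Let $\mu$ be a probability measure on $\mathbb R$ with cumulative distribution function $F(x)=\mu((-\infty,x])$ and let $\rho\ge 1$ be real. For probability measures $\nu,\eta$ on $\mathbb R$ let $$\mathcal W_\rho(\nu,\eta)=\inf_{\pi}\Big(\int_{\mathbb R\times\mathbb R}|x-y|^\rho\,\pi(dx,dy)\Big)^{1/\rho}\in[0,\infty],$$ where the infimum is over all couplings $\pi$ of $\nu$ and $\eta$ (measures on $\mathbb R\times\mathbb R$ with marginals $\nu$ and $\eta$), and for $N\ge 1$ let $$e_N(\mu,\rho)=\inf\Big\{\mathcal W_\rho\Big(\frac1N\sum_{i=1}^N\delta_{x_i},\mu\Big): -\infty<x_1\le\cdots\le x_N<\infty\Big\}\in[0,\infty].$$ Then, in $[0,\infty]$, $$\forall N\ge 1,\quad N e_N(\mu,\rho)+(N+1)e_{N+1}(\mu,\rho)\ \ge\ \frac12\int_{\mathbb R}\min\big(F(x),1-F(x)\big)\,dx .$$ Hence, unless $\mu$ is a Dirac mass, the order of convergence of $e_N(\mu,\rho)$ is at most $1$: if $\mu$ is not a Dirac mass, then $\limsup_{N\to\infty}N e_N(\mu,\rho)>0$, and every $\alpha\in\mathbb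 R$ with $\sup_{N\ge1}N^\alpha e_N(\mu,\rho)<\infty$ satisfies $\alpha\le 1$. -/

import Mathlib

open MeasureTheory ProbabilityTheory Filter
open scoped ENNReal

noncomputable section

/-- `π` is a coupling of `ν` and `η`: a measure on `ℝ × ℝ` with marginals `ν` and `η`. -/
def IsCoupling (π : Measure (ℝ × ℝ)) (ν η : Measure ℝ) : Prop :=
  π.fst = ν ∧ π.snd = η

/-- The Wasserstein distance with index `ρ` on the real line, with values in `[0, ∞]`:
the infimum over all couplings `π` of `(∫ |x - y| ^ ρ dπ(x, y)) ^ (1 / ρ)`. -/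
def wasserstein (ρ : ℝ) (ν η : Measure ℝ) : ℝ≥0∞ :=
  ⨅ (π : Measure (ℝ × ℝ)) (_ : IsCoupling π ν η),
    (∫⁻ p, ENNReal.ofReal (|p.1 - p.2| ^ ρ) ∂π) ^ (1 / ρ)

/-- The empirical measure `N⁻¹ ∑ δ_{x_i}` of `N` points of the real line (for `N ≥ 1`). -/
def empiricalMeasure {N : ℕ} (x : Fin N → ℝ) : Measure ℝ :=
  (N : ℝ≥0∞)⁻¹ • ∑ i, Measure.dirac (x i)

/-- The minimal error `e_N(μ, ρ)` in the approximation of `μ`, in Wasserstein distance with index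
`ρ`, by the empirical measure of `N` deterministic points `x_1 ≤ ⋯ ≤ x_N`. -/
def minError (N : ℕ) (μ : Measure ℝ) (ρ : ℝ) : ℝ≥0∞ :=
  ⨅ (x : Fin N → ℝ) (_ : Monotone x), wasserstein ρ (empiricalMeasure x) μ

end

/-! Write `F` for the distribution function of `μ`. That of an `N`-point empirical measure takes
values in `ℤ/N`, and `W_ρ ≥ W_1 ≥ ∫ |F_ν - F_η|`, so `N e_N ≥ ∫ dist(N F, ℤ)`. Since `F = (N + 1) F
- N F`, the distances of `N F` and `(N + 1) F` to `ℤ` add up to at least `dist(F, ℤ) ≥ min(F, 1 -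
F)`; integrating gives the bound. Its right side is positive unless `F` only takes the values `0`
and `1`. -/

/-- Layer-cake bound: the mean distance of the two coordinates dominates the `L¹` distance of the
distribution functions of the marginals. -/
theorem lintegral_abs_cdf_fst_sub_cdf_snd_le (π : Measure (ℝ × ℝ)) [IsProbabilityMeasure π] :
    ∫⁻ t : ℝ, ENNReal.ofReal |cdf π.fst t - cdf π.snd t| ≤
      ∫⁻ p, ENNReal.ofReal |p.1 - p.2| ∂π := by
  -- Half-open, so that `t` is in the section at `p` iff exactly one of `p.1 ≤ t`, `p.2 ≤ t` holds.
  -- Tonelli then measures `S` in both orders.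
  let S : Set ((ℝ × ℝ) × ℝ) := {q | min q.1.1 q.1.2 ≤ q.2 ∧ q.2 < max q.1.1 q.1.2}
  have hS : MeasurableSet S := by
    have m1 : Measurable fun q : (ℝ × ℝ) × ℝ => min q.1.1 q.1.2 := by fun_prop
    have m2 : Measurable fun q : (ℝ × ℝ) × ℝ => max q.1.1 q.1.2 := by fun_prop
    exact (measurableSet_le m1 measurable_snd).inter (measurableSet_lt measurable_snd m2)
  have h1 : (π.prod volume) S = ∫⁻ p, ENNReal.ofReal |p.1 - p.2| ∂π := by
    rw [Measure.prod_apply hS]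
    refine lintegral_congr fun p => ?_
    have : Prod.mk p ⁻¹' S = Set.Ico (min p.1 p.2) (max p.1 p.2) := by
      ext t; simp [S]
    rw [this, Real.volume_Ico, max_sub_min_eq_abs']
  rw [← h1, Measure.prod_apply_symm hS]
  refine lintegral_mono fun t => ?_
  have e1 : cdf π.fst t = π.real {p | p.1 ≤ t} := by
    rw [cdf_eq_real, measureReal_def, Measure.fst_apply measurableSet_Iic, measureReal_def]
    rfl
  have e2 : cdf π.snd t = π.real {p | p.2 ≤ t} := by
    rw [cdf_eq_real, measureReal_def, Measure.snd_apply measurableSet_Iic, measureReal_def]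
    rfl
  set T : Set (ℝ × ℝ) := (fun p => (p, t)) ⁻¹' S with hT
  have i1 : {p : ℝ × ℝ | p.1 ≤ t} ⊆ {p | p.2 ≤ t} ∪ T := by
    intro p hp
    by_cases h : p.2 ≤ t
    · exact Or.inl h
    · exact Or.inr ⟨(min_le_left _ _).trans hp, lt_max_of_lt_right (not_le.1 h)⟩
  have i2 : {p : ℝ × ℝ | p.2 ≤ t} ⊆ {p | p.1 ≤ t} ∪ T := by
    intro p hp
    by_cases h : p.1 ≤ t
    · exact Or.inl h
    · exact Or.inr ⟨(min_le_right _ _).trans hp, lt_max_of_lt_left (not_le.1 h)⟩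
  have j1 := (measureReal_mono (μ := π) i1).trans (measureReal_union_le _ _)
  have j2 := (measureReal_mono (μ := π) i2).trans (measureReal_union_le _ _)
  refine ENNReal.ofReal_le_of_le_toReal ?_
  rw [e1, e2, abs_le]
  change -π.real T ≤ _ ∧ _ ≤ π.real T
  constructor <;> linarith

/-- On a probability space the `L¹` norm is at most the `L^ρ` norm. -/
theorem lintegral_ofReal_abs_le_rpow {Ω : Type*} [MeasurableSpace Ω] (P : Measure Ω)
    [IsProbabilityMeasure P] {f : Ω → ℝ} (hf : Measurable f) {ρ : ℝ} (hρ : 1 ≤ ρ) :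
    ∫⁻ p, ENNReal.ofReal |f p| ∂P ≤ (∫⁻ p, ENNReal.ofReal (|f p| ^ ρ) ∂P) ^ (1 / ρ) := by
  have h0 : 0 < ρ := by linarith
  have h := eLpNorm'_le_eLpNorm'_of_exponent_le (μ := P) one_pos hρ hf.aestronglyMeasurable
  simp only [eLpNorm'_eq_lintegral_enorm, ENNReal.rpow_one, one_div, inv_one] at h
  simpa only [Real.enorm_eq_ofReal_abs, one_div, ENNReal.ofReal_rpow_of_nonneg (abs_nonneg _) h0.le]
    using h

theorem lintegral_abs_cdf_sub_le_wasserstein {ρ : ℝ} (hρ : 1 ≤ ρ) (ν η : Measure ℝ)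
    [IsProbabilityMeasure ν] :
    ∫⁻ t : ℝ, ENNReal.ofReal |cdf ν t - cdf η t| ≤ wasserstein ρ ν η := by
  refine le_iInf₂ fun π hπ => ?_
  obtain ⟨rfl, rfl⟩ := hπ
  have : IsProbabilityMeasure π := ⟨by rw [← Measure.fst_univ]; exact measure_univ⟩
  exact (lintegral_abs_cdf_fst_sub_cdf_snd_le π).trans
    (lintegral_ofReal_abs_le_rpow π (f := fun p => p.1 - p.2) (by fun_prop) hρ)

theorem isProbabilityMeasure_empiricalMeasure {N : ℕ} (hN : 1 ≤ N) (x : Fin N → ℝ) :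
    IsProbabilityMeasure (empiricalMeasure x) := by
  constructor
  have : (N : ℝ≥0∞) ≠ 0 := by simp; omega
  simp [empiricalMeasure, ENNReal.inv_mul_cancel this (ENNReal.natCast_ne_top N)]

theorem exists_nat_mul_cdf_empiricalMeasure {N : ℕ} (hN : 1 ≤ N) (x : Fin N → ℝ) (t : ℝ) :
    ∃ k : ℕ, (N : ℝ) * cdf (empiricalMeasure x) t = k := by
  classical
  have := isProbabilityMeasure_empiricalMeasure hN x
  have h0 : (N : ℝ) ≠ 0 := by simp; omega
  refine ⟨(Finset.univ.filter fun i => x i ≤ t).card, ?_⟩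
  rw [cdf_eq_real, measureReal_def]
  simp [empiricalMeasure, Set.indicator_apply, h0, Finset.sum_boole]

/-- `N` times the error dominates the integrated distance of `N F` to the integers. -/
theorem lintegral_abs_sub_round_le_mul_minError {ρ : ℝ} (hρ : 1 ≤ ρ) (μ : Measure ℝ) {N : ℕ}
    (hN : 1 ≤ N) :
    ∫⁻ t : ℝ, ENNReal.ofReal |N * cdf μ t - round (N * cdf μ t)| ≤
      (N : ℝ≥0∞) * minError N μ ρ := by
  have h0 : (N : ℝ≥0∞) ≠ 0 := by simp; omega
  rw [minError, ENNReal.mul_iInf_of_ne h0 (ENNReal.natCast_ne_top N)]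
  refine le_iInf fun x => ?_
  rw [ENNReal.mul_iInf_of_ne h0 (ENNReal.natCast_ne_top N)]
  refine le_iInf fun _ => ?_
  have := isProbabilityMeasure_empiricalMeasure hN x
  refine le_trans ?_ (mul_le_mul_right (lintegral_abs_cdf_sub_le_wasserstein hρ _ μ) _)
  rw [← lintegral_const_mul' _ _ (ENNReal.natCast_ne_top N)]
  refine lintegral_mono fun t => ?_
  obtain ⟨k, hk⟩ := exists_nat_mul_cdf_empiricalMeasure hN x t
  rw [← ENNReal.ofReal_natCast N, ← ENNReal.ofReal_mul (Nat.cast_nonneg N)]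
  refine ENNReal.ofReal_le_ofReal ?_
  rw [← abs_of_nonneg (Nat.cast_nonneg (α := ℝ) N), ← abs_mul,
    abs_of_nonneg (Nat.cast_nonneg (α := ℝ) N), mul_sub, hk, abs_sub_comm (k : ℝ)]
  exact_mod_cast round_le (N * cdf μ t) (k : ℤ)

theorem min_self_one_sub_le_abs_sub_intCast (u : ℝ) (m : ℤ) : min u (1 - u) ≤ |u - m| := by
  rcases le_or_gt m 0 with h | h
  · have : (m : ℝ) ≤ 0 := by exact_mod_cast h
    exact (min_le_left _ _).trans (le_trans (by linarith) (le_abs_self _))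
  · have : (1 : ℝ) ≤ m := by exact_mod_cast h
    exact (min_le_right _ _).trans (le_trans (by linarith) (neg_le_abs _))

theorem lintegral_min_cdf_le {ρ : ℝ} (hρ : 1 ≤ ρ) (μ : Measure ℝ) {N : ℕ} (hN : 1 ≤ N) :
    ∫⁻ x : ℝ, ENNReal.ofReal (min (cdf μ x) (1 - cdf μ x)) ≤
      (N : ℝ≥0∞) * minError N μ ρ + ((N + 1 : ℕ) : ℝ≥0∞) * minError (N + 1) μ ρ := by
  refine le_trans ?_ (add_le_add (lintegral_abs_sub_round_le_mul_minError hρ μ hN)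
    (lintegral_abs_sub_round_le_mul_minError hρ μ (Nat.le_add_left 1 N)))
  have hF : Measurable (cdf μ) := (monotone_cdf μ).measurable
  have hmeas : Measurable fun t : ℝ =>
      ENNReal.ofReal |N * cdf μ t - round (N * cdf μ t)| := by
    -- The fractional part makes measurability visible.
    simp only [abs_sub_round_eq_min]
    have := measurable_fract.comp (hF.const_mul (N : ℝ))
    exact (this.min (measurable_const.sub this)).ennreal_ofReal
  rw [← lintegral_add_left hmeas]
  refine lintegral_mono fun t => ?_
  rw [← ENNReal.ofReal_add (abs_nonneg _) (abs_nonneg _)]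
  refine ENNReal.ofReal_le_ofReal ?_
  set F := cdf μ t
  set a := round ((N : ℝ) * F)
  set b := round (((N + 1 : ℕ) : ℝ) * F)
  -- `F - (b - a)` is the difference of the two rounding errors.
  refine (min_self_one_sub_le_abs_sub_intCast F (b - a)).trans ?_
  have h := abs_sub ((((N + 1 : ℕ) : ℝ)) * F - b) (N * F - a)
  refine le_trans (le_of_eq ?_) (h.trans (add_comm _ _).le)
  congr 1
  push_cast
  ring

/-- A probability measure on `ℝ` whose distribution function only takes the values `0` and `1` is
a Dirac mass. -/
theorem exists_eq_dirac_of_cdf_zero_or_one (μ : Measure ℝ) [IsProbabilityMeasure μ]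
    (h : ∀ x, cdf μ x = 0 ∨ cdf μ x = 1) : ∃ a, μ = Measure.dirac a := by
  let A : Set ℝ := {x | cdf μ x = 1}
  have hne : A.Nonempty := by
    obtain ⟨x, hx⟩ := ((tendsto_cdf_atTop μ).eventually (lt_mem_nhds one_pos)).exists
    exact ⟨x, (h x).resolve_left hx.ne'⟩
  obtain ⟨l, hl⟩ := ((tendsto_cdf_atBot μ).eventually (gt_mem_nhds one_pos)).exists
  have hbdd : BddBelow A := ⟨l, fun x (hx : cdf μ x = 1) => by
    by_contra! hlt
    have := monotone_cdf μ hlt.le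
    linarith⟩
  have hgt : ∀ y, sInf A < y → cdf μ y = 1 := fun y hy => by
    obtain ⟨x, hx : cdf μ x = 1, hxy⟩ := exists_lt_of_csInf_lt hne hy
    have := monotone_cdf μ hxy.le
    exact le_antisymm (cdf_le_one μ y) (by linarith)
  -- Right continuity puts the infimum itself in `A`.
  have ha : cdf μ (sInf A) = 1 := by
    have hc : Tendsto (cdf μ) (nhdsWithin (sInf A) (Set.Ioi (sInf A))) (nhds (cdf μ (sInf A))) :=
      ((cdf μ).right_continuous (sInf A)).mono_left (nhdsWithin_mono _ Set.Ioi_subset_Ici_self)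
    refine tendsto_nhds_unique hc (tendsto_const_nhds.congr' ?_)
    filter_upwards [self_mem_nhdsWithin] with y hy using (hgt y hy).symm
  refine ⟨sInf A, Measure.eq_of_cdf _ _ (StieltjesFunction.ext fun y => ?_)⟩
  rw [cdf_eq_real (Measure.dirac (sInf A)), measureReal_def,
    Measure.dirac_apply' _ measurableSet_Iic]
  by_cases hy : sInf A ≤ y
  · have : cdf μ y = 1 := hy.eq_or_lt.elim (fun e => e ▸ ha) (hgt y)
    simp [hy, this]
  · have : cdf μ y = 0 := (h y).resolve_right fun e => hy (csInf_le hbdd e)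
    simp [hy, this]

theorem lintegral_min_cdf_pos (μ : Measure ℝ) [IsProbabilityMeasure μ]
    (hμ : ∀ a : ℝ, μ ≠ Measure.dirac a) :
    0 < ∫⁻ x : ℝ, ENNReal.ofReal (min (cdf μ x) (1 - cdf μ x)) := by
  obtain ⟨x, hx0, hx1⟩ : ∃ x, cdf μ x ≠ 0 ∧ cdf μ x ≠ 1 := by
    by_contra! hcon
    obtain ⟨a, ha⟩ := exists_eq_dirac_of_cdf_zero_or_one μ fun x => or_iff_not_imp_left.2 (hcon x)
    exact hμ a ha
  have hx0 : 0 < cdf μ x := (cdf_nonneg μ x).lt_of_ne' hx0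
  have hx1 : cdf μ x < 1 := (cdf_le_one μ x).lt_of_ne hx1
  -- Right continuity keeps `F < 1` on some `[x, y)`, and monotonicity keeps `F > 0` there.
  have hev := ((cdf μ).right_continuous x).eventually (gt_mem_nhds hx1)
  obtain ⟨y, hy, hsub⟩ := (mem_nhdsGE_iff_exists_Ico_subset).1 hev
  have hmeas : Measurable (cdf μ) := (monotone_cdf μ).measurable
  rw [lintegral_pos_iff_support (by fun_prop)]
  refine lt_of_lt_of_le ?_ (measure_mono (s := Set.Ico x y) fun z hz => ?_)
  · simpa using hy
  · have h1 : cdf μ z < 1 := hsub hz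
    have h0 := hx0.trans_le (monotone_cdf μ hz.1)
    simpa [Function.mem_support] using ⟨h0, h1⟩

/-- Otherwise two consecutive terms would both be below `C / 2`. -/
theorem limsup_pos_of_le_add_succ {u : ℕ → ℝ≥0∞} {C : ℝ≥0∞} (hC : 0 < C)
    (h : ∀ N, 1 ≤ N → C ≤ u N + u (N + 1)) : 0 < limsup u atTop := by
  by_contra hcon
  have hlt : limsup u atTop < C / 2 :=
    (not_lt.1 hcon).trans_lt (ENNReal.div_pos hC.ne' (by simp))
  obtain ⟨N, hN⟩ := eventually_atTop.1 (eventually_lt_of_limsup_lt hlt)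
  have := ENNReal.add_lt_add (hN (N + 1) (by omega)) (hN (N + 2) (by omega))
  rw [ENNReal.add_halves] at this
  exact absurd (h (N + 1) (by omega)) (not_le.2 this)

/-- With `K` the supremum, `N e_N ≤ N ^ (1 - α) K`, which tends to `0`. -/
theorem limsup_natCast_mul_eq_zero {e : ℕ → ℝ≥0∞} {α : ℝ} (hα : 1 < α)
    (h : (⨆ (N : ℕ) (_ : 1 ≤ N), (N : ℝ≥0∞) ^ α * e N) < ∞) :
    limsup (fun N : ℕ => (N : ℝ≥0∞) * e N) atTop = 0 := by
  set K := ⨆ (N : ℕ) (_ : 1 ≤ N), (N : ℝ≥0∞) ^ α * e N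
  have h1 : Tendsto (fun N : ℕ => (N : ℝ≥0∞) ^ (1 - α)) atTop (nhds 0) := by
    have := (ENNReal.tendsto_rpow_at_top (sub_pos.2 hα)).comp ENNReal.tendsto_nat_nhds_top
    have := tendsto_inv_iff.2 this
    rw [ENNReal.inv_top] at this
    refine this.congr fun N => ?_
    simp only [Function.comp, ← ENNReal.rpow_neg, neg_sub]
  have h2 : Tendsto (fun N : ℕ => (N : ℝ≥0∞) ^ (1 - α) * K) atTop (nhds 0) := by
    simpa using ENNReal.Tendsto.mul_const h1 (Or.inr h.ne)
  refine Tendsto.limsup_eq (tendsto_of_tendsto_of_tendsto_of_le_of_le' tendsto_const_nhds h2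
    (Eventually.of_forall fun _ => zero_le) ?_)
  filter_upwards [eventually_ge_atTop 1] with N hN
  have h0 : (N : ℝ≥0∞) ≠ 0 := by simp; omega
  calc (N : ℝ≥0∞) * e N = (N : ℝ≥0∞) ^ (1 - α) * ((N : ℝ≥0∞) ^ α * e N) := by
        rw [← mul_assoc, ← ENNReal.rpow_add _ _ h0 (ENNReal.natCast_ne_top N), sub_add_cancel,
          ENNReal.rpow_one]
    _ ≤ _ := by
        gcongr
        exact le_iSup₂ (f := fun (N : ℕ) (_ : 1 ≤ N) => (N : ℝ≥0∞) ^ α * e N) N hN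

theorem lemma2 (μ : Measure ℝ) [IsProbabilityMeasure μ] (ρ : ℝ) (hρ : 1 ≤ ρ) :
    (∀ N : ℕ, 1 ≤ N →
      2⁻¹ * ∫⁻ x : ℝ, ENNReal.ofReal (min (cdf μ x) (1 - cdf μ x)) ≤
        (N : ℝ≥0∞) * minError N μ ρ + ((N + 1 : ℕ) : ℝ≥0∞) * minError (N + 1) μ ρ) ∧
    ((∀ a : ℝ, μ ≠ Measure.dirac a) →
      0 < limsup (fun N : ℕ => (N : ℝ≥0∞) * minError N μ ρ) atTop ∧
      ∀ α : ℝ, (⨆ (N : ℕ) (_ : 1 ≤ N), (N : ℝ≥0∞) ^ α * minError N μ ρ) < ∞ → α ≤ 1) := by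
  refine ⟨fun N hN => le_trans ?_ (lintegral_min_cdf_le hρ μ hN), fun hμ => ?_⟩
  -- The argument gives constant `1`; the factor `1/2` is slack.
  · exact mul_le_of_le_one_left zero_le (ENNReal.inv_le_one.2 one_le_two)
  · have hpos := limsup_pos_of_le_add_succ (u := fun N : ℕ => (N : ℝ≥0∞) * minError N μ ρ)
      (lintegral_min_cdf_pos μ hμ)
      fun N hN => lintegral_min_cdf_le hρ μ hN
    refine ⟨hpos, fun α hα => ?_⟩
    by_contra! h
    exact hpos.ne' (limsup_natCast_mul_eq_zero (e := fun N => minError N μ ρ) h hα)
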